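/- Let $\mathcal A$ be an abelian category that is hereditary (i.e. of global dimension at most one: $\operatorname{Ext}^i_{\mathcal A}(X,Y)=0$ for all $X,Y\in\mathcal A$ and all $i\ge 2$) and that has enough injectives. Let $D^b\mathcal A$ be its bounded derived category, and for $k\in\mathbb Z$ let $H_k=H^{-k}\colon D^b\mathcal A\to\mathcal A$ be the homology functors. All subcategories are full and closed under isomorphisms. A *narrow subcategory* of $\mathcal A$ is a full subcategory closed under extensions and cokernels. A *narrow sequence* in $\mathcal A$ is a sequence $(\mathcal N(k))_{k\in\mathbb Z}$ of narrow subcategories such that for all $k\in\mathbb Z$: (1) $\mathcal N(k)\subseteq\mathcal N(k+1)$; and (2) if $A\to B\to C\to D\to E$ is exact with $A\in\mathcal N(k+1)$, $B,D\in\mathcal N(k)$ and $E\in\mathcal N(k-1)$, then $C\in\mathcal N(k)$. It is *coreflective* if each embedding $\mathcal N(k)\to\mathcal A$ has a right adjoint. For a $t$-structure $t=(D^{\le 0},D^{\ge 0})$ on $D^b\mathcal A$ let $\mu(t)=(H_k(D^{\le 0}))_{k\in\mathbb Z}$. For a coreflective narrow sequence $\mathcal N=(\mathcal N(k))_{k\in\mathbb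 Z}$ let $\theta(\mathcal N)$ be the full subcategory of all $X\in D^b\mathcal A$ with $H_k(X)\in\mathcal N(k)$ for all $k\in\mathbb Z$. Then, for every $t$-structure $t$ on $D^b\mathcal A$, the sequence $\mu(t)$ is a coreflective narrow sequence; for every coreflective narrow sequence $\mathcal N$, there is a unique $t$-structure on $D^b\mathcal A$ with $D^{\le 0}=\theta(\mathcal N)$; and the resulting maps $$\{t\text{-structures on } D^b\mathcal A\}\;\overset{\mu}{\underset{\theta}{\rightleftarrows}}\;\{\text{coreflective narrow sequences in }\mathcal A\}$$ are mutually inverse bijections. -/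

import Mathlib

open CategoryTheory CategoryTheory.Limits CategoryTheory.Triangulated

universe w v u

namespace NarrowSequences

section Abelian

variable {A : Type u} [Category.{v} A] [Abelian A]

/-- An abelian category is hereditary if its global dimension is at most one, i.e. if every
object has projective dimension at most one (`Ext^i (X, Y) = 0` for all `X`, `Y` and `i ≥ 2`). -/
def IsHereditary (A : Type u) [Category.{v} A] [Abelian A] : Prop :=
  ∀ X : A, HasProjectiveDimensionLE X 1

/-- A narrow subcategory: a full replete subcategory closed under extensions and cokernels. -/
structure IsNarrow (N : ObjectProperty A) : Prop where
  isClosedUnderIsomorphisms : N.IsClosedUnderIsomorphisms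
  isClosedUnderExtensions : N.IsClosedUnderExtensions
  isClosedUnderCokernels : N.IsClosedUnderCokernels

/-- A narrow sequence: a nondecreasing sequence of narrow subcategories such that, whenever
`X₁ ⟶ X₂ ⟶ X₃ ⟶ X₄ ⟶ X₅` is exact with `X₁` in `N (k + 1)`, `X₂` and `X₄` in `N k` and
`X₅` in `N (k - 1)`, the object `X₃` is in `N k`. -/
structure IsNarrowSequence (N : ℤ → ObjectProperty A) : Prop where
  isNarrow (k : ℤ) : IsNarrow (N k)
  le_succ (k : ℤ) : N k ≤ N (k + 1)
  prop_of_exact (k : ℤ) {X₁ X₂ X₃ X₄ X₅ : A}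
    (f₁ : X₁ ⟶ X₂) (f₂ : X₂ ⟶ X₃) (f₃ : X₃ ⟶ X₄) (f₄ : X₄ ⟶ X₅)
    (exact : (ComposableArrows.mk₄ f₁ f₂ f₃ f₄).Exact)
    (h₁ : N (k + 1) X₁) (h₂ : N k X₂) (h₄ : N k X₄) (h₅ : N (k - 1) X₅) : N k X₃

/-- A coreflective narrow sequence: a narrow sequence in which the embedding of each
subcategory `N k` into `A` has a right adjoint. -/
structure IsCoreflectiveNarrowSequence (N : ℤ → ObjectProperty A) : Prop
    extends IsNarrowSequence N where
  isLeftAdjoint_ι (k : ℤ) : (N k).ι.IsLeftAdjoint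

end Abelian

section Derived

variable {A : Type u} [Category.{v} A] [Abelian A] [HasDerivedCategory.{w} A]

/-- The homology functor `H_k = H^{-k}` from the bounded derived category to `A`, with
homological indexing. -/
noncomputable def homology (k : ℤ) : DerivedCategory.Bounded A ⥤ A :=
  DerivedCategory.Bounded.ι ⋙ DerivedCategory.homologyFunctor A (-k)

/-- `mu U` is the sequence of full (replete) subcategories `H_k U` of `A`. -/
noncomputable def mu (U : ObjectProperty (DerivedCategory.Bounded A)) (k : ℤ) :
    ObjectProperty A :=
  U.map (homology k)

/-- `theta N` is the full subcategory of the bounded derived category consisting of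
the objects `X` such that `H_k X` is in `N k` for all `k`. -/
noncomputable def theta (N : ℤ → ObjectProperty A) :
    ObjectProperty (DerivedCategory.Bounded A) :=
  fun X ↦ ∀ k : ℤ, N k ((homology k).obj X)

end Derived

end NarrowSequences

/-! In the hereditary case Ext² vanishes, so every object of the derived category is a finite sum of
its shifted homology objects. An aisle is closed under extensions, `⟦1⟧` and retracts, hence it is
determined by its homology: `theta_mu`. Cones, fibres and extensions of objects in degree `k` give
the narrow axioms for `mu`, and truncating `M` in degree `k` gives the coreflections.

Conversely, the five-term axiom is the long exact homology sequence, so `theta N` is closed under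
extensions. The work is to find a truncation triangle for each object; by splitting, it suffices to
treat `M` in degree `k` (`approximable_single`). Let `C` be the cone of the coreflection `T ⟶ M` in
`N k`. Its homology in degree `k + 1` is already orthogonal to `theta N`. Its homology `Q` in degree
`k` receives no map from `N k`, but may have Ext¹ from `N (k - 1)`. This Ext¹ is represented by an
object of `N (k - 1)` (`exists_universal_extension`, where enough injectives are used), and the cone
of the universal class is orthogonal to `theta N` (`approximable_single_of_hom_eq_zero`). -/

namespace NarrowSequences

open Pretriangulated

/-! ### Homology and complexes concentrated in one degree -/

section Basic

variable (A : Type u) [Category.{v} A] [Abelian A] [HasDerivedCategory.{w} A]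

/-- The canonical t-structure on the bounded derived category. -/
noncomputable abbrev canonical : TStructure (DerivedCategory.Bounded A) :=
  ObjectProperty.tStructure _ DerivedCategory.TStructure.t

/-- The embedding of `A` in the bounded derived category as the complexes concentrated in
homological degree `k`. -/
noncomputable def single (k : ℤ) : A ⥤ DerivedCategory.Bounded A :=
  ObjectProperty.lift _ (DerivedCategory.singleFunctor A (-k))
    (fun _ ↦ ⟨⟨-k, inferInstance⟩, ⟨-k, inferInstance⟩⟩)

instance (k : ℤ) : (single A k).Faithful :=
  Functor.Faithful.of_comp_iso (G := DerivedCategory.Bounded.ι)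
    (H := DerivedCategory.singleFunctor A (-k)) (Iso.refl _)

instance (k : ℤ) : (single A k).Full :=
  Functor.Full.of_comp_faithful_iso (G := DerivedCategory.Bounded.ι)
    (H := DerivedCategory.singleFunctor A (-k)) (Iso.refl _)

instance (k : ℤ) : (homology (A := A) k).IsHomological :=
  inferInstanceAs (DerivedCategory.Bounded.ι ⋙ DerivedCategory.homologyFunctor A (-k)).IsHomological

instance (k : ℤ) : (homology (A := A) k).Additive :=
  inferInstanceAs (DerivedCategory.Bounded.ι ⋙ DerivedCategory.homologyFunctor A (-k)).Additive

/-- The homology functor `H_k` is a retraction of `single A k`. -/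
noncomputable def singleHomologyIso (k : ℤ) : single A k ⋙ homology k ≅ 𝟭 A :=
  DerivedCategory.singleFunctorCompHomologyFunctorIso A (-k)

instance (k : ℤ) : (single A k).Additive := by
  have : (single A k ⋙ DerivedCategory.Bounded.ι).Additive :=
    inferInstanceAs (DerivedCategory.singleFunctor A (-k)).Additive
  exact Functor.additive_of_comp_faithful _ DerivedCategory.Bounded.ι

variable {A}

/-- Shifting a complex concentrated in degree `k` gives one concentrated in degree `k + 1`. -/
noncomputable def singleShiftIso (X : A) (k k' : ℤ) (h : k + 1 = k' := by lia) :
    ((single A k).obj X)⟦(1 : ℤ)⟧ ≅ (single A k').obj X :=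
  ObjectProperty.isoMk _ ((DerivedCategory.Bounded.ι.commShiftIso (1 : ℤ)).app _ ≪≫
    ((DerivedCategory.singleFunctors A).shiftIso 1 (-k') (-k) (by lia)).app X)

/-- `H_k (X⟦1⟧)` is `H_{k-1} X`. -/
noncomputable def homologyShiftIso (X : DerivedCategory.Bounded A) (k k' : ℤ)
    (h : k + 1 = k' := by lia) :
    (homology k').obj (X⟦(1 : ℤ)⟧) ≅ (homology k).obj X :=
  (DerivedCategory.homologyFunctor A (-k')).mapIso
    ((DerivedCategory.Bounded.ι.commShiftIso (1 : ℤ)).app X) ≪≫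
    ((DerivedCategory.homologyFunctor A 0).shiftIso 1 (-k') (-k) (by lia)).app X.obj

lemma canonical_isLE_iff (X : DerivedCategory.Bounded A) (n : ℤ) :
    (canonical A).IsLE X n ↔ ∀ k < -n, IsZero ((homology k).obj X) := by
  rw [ObjectProperty.tStructure_isLE_iff]
  refine (DerivedCategory.isLE_iff X.obj n).trans ⟨fun h k hk ↦ h (-k) (by lia), fun h i hi ↦ ?_⟩
  have := h (-i) (by lia)
  dsimp [homology] at this
  rwa [neg_neg] at this

lemma canonical_isGE_iff (X : DerivedCategory.Bounded A) (n : ℤ) :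
    (canonical A).IsGE X n ↔ ∀ k, -n < k → IsZero ((homology k).obj X) := by
  rw [ObjectProperty.tStructure_isGE_iff]
  refine (DerivedCategory.isGE_iff X.obj n).trans ⟨fun h k hk ↦ h (-k) (by lia), fun h i hi ↦ ?_⟩
  have := h (-i) (by lia)
  dsimp [homology] at this
  rwa [neg_neg] at this

lemma isLE_single (X : A) (k n : ℤ) (h : -k ≤ n) : (canonical A).IsLE ((single A k).obj X) n := by
  have : (canonical A).IsLE ((single A k).obj X) (-k) := by
    rw [ObjectProperty.tStructure_isLE_iff]
    exact inferInstanceAs (((DerivedCategory.singleFunctor A (-k)).obj X).IsLE (-k))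
  exact (canonical A).isLE_of_le _ _ _ h

lemma isGE_single (X : A) (k n : ℤ) (h : n ≤ -k) : (canonical A).IsGE ((single A k).obj X) n := by
  have : (canonical A).IsGE ((single A k).obj X) (-k) := by
    rw [ObjectProperty.tStructure_isGE_iff]
    exact inferInstanceAs (((DerivedCategory.singleFunctor A (-k)).obj X).IsGE (-k))
  exact (canonical A).isGE_of_ge _ _ _ h

lemma isZero_homology_single (X : A) (j k : ℤ) (h : j ≠ k) :
    IsZero ((homology j).obj ((single A k).obj X)) := by
  obtain h | h := lt_or_gt_of_ne h
  · exact (canonical_isLE_iff _ _).1 (isLE_single X k (-k) le_rfl) _ (by lia)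
  · exact (canonical_isGE_iff _ _).1 (isGE_single X k (-k) le_rfl) _ (by lia)

lemma exists_iso_single (X : DerivedCategory.Bounded A) (k : ℤ)
    [hX : (canonical A).IsGE X (-k)] [hX' : (canonical A).IsLE X (-k)] :
    Nonempty (X ≅ (single A k).obj ((homology k).obj X)) := by
  rw [ObjectProperty.tStructure_isGE_iff] at hX
  rw [ObjectProperty.tStructure_isLE_iff] at hX'
  obtain ⟨Y, ⟨e⟩⟩ :=
    DerivedCategory.exists_iso_singleFunctor_obj_of_isGE_of_isLE X.obj (-k)
  let e' : X ≅ (single A k).obj Y := ObjectProperty.isoMk _ e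
  exact ⟨e' ≪≫ (single A k).mapIso
    (((homology k).mapIso e' ≪≫ (singleHomologyIso A k).app Y).symm)⟩

lemma exists_triangle_of_shortExact {S : ShortComplex A} (hS : S.ShortExact) (k : ℤ) :
    ∃ δ, Triangle.mk ((single A k).map S.f) ((single A k).map S.g) δ ∈
      distTriang (DerivedCategory.Bounded A) := by
  have h := DerivedCategory.triangleOfSES_distinguished
    (hS.map_of_exact (HomologicalComplex.single A (ComplexShape.up ℤ) (-k)))
  let δ : DerivedCategory.Bounded.ι.obj ((single A k).obj S.X₃) ⟶
      (DerivedCategory.Bounded.ι.obj ((single A k).obj S.X₁))⟦(1 : ℤ)⟧ :=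
    DerivedCategory.triangleOfSESδ
      (hS.map_of_exact (HomologicalComplex.single A (ComplexShape.up ℤ) (-k)))
  refine ⟨ObjectProperty.homMk (δ ≫ (DerivedCategory.Bounded.ι.commShiftIso (1 : ℤ)).inv.app _), ?_⟩
  refine isomorphic_distinguished _ h _ (Triangle.isoMk _ _ (Iso.refl _) (Iso.refl _) (Iso.refl _)
    ?_ ?_ ?_)
  · refine (Category.comp_id _).trans (Eq.trans ?_ (Category.id_comp _).symm)
    rfl
  · refine (Category.comp_id _).trans (Eq.trans ?_ (Category.id_comp _).symm)
    rfl
  · refine (congrArg (_ ≫ ·) (CategoryTheory.Functor.map_id _ _)).trans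
      ((Category.comp_id _).trans (Eq.trans ?_ (Category.id_comp _).symm))
    change (δ ≫ (DerivedCategory.Bounded.ι.commShiftIso (1 : ℤ)).inv.app _) ≫
      (DerivedCategory.Bounded.ι.commShiftIso (1 : ℤ)).hom.app _ = δ
    rw [Category.assoc, Iso.inv_hom_id_app]
    exact Category.comp_id _

end Basic

/-! ### Vanishing of morphisms between shifted objects -/

section Vanishing

variable {A : Type u} [Category.{v} A] [Abelian A] [HasDerivedCategory.{w} A]

lemma hom_single_eq_zero_of_lt {X Y : A} {j k : ℤ} (h : k < j)
    (f : (single A j).obj X ⟶ (single A k).obj Y) : f = 0 :=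
  (canonical A).zero_of_isLE_of_isGE f (-j) (-k) (by lia) (isLE_single _ _ _ le_rfl)
    (isGE_single _ _ _ le_rfl)

lemma hom_single_eq_zero_of_injective {X I : A} [Injective I] {j k : ℤ} (h : j < k)
    (f : (single A j).obj X ⟶ (single A k).obj I) : f = 0 := by
  apply DerivedCategory.Bounded.ι.map_injective
  have := CochainComplex.isStrictlyGE_of_ge ((CochainComplex.singleFunctor A (-j)).obj X) (-j) (-j)
    le_rfl
  exact (DerivedCategory.to_singleFunctor_obj_eq_zero_of_injective (I := I) (i := -k)
    (K := (CochainComplex.singleFunctor A (-j)).obj X)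
    (DerivedCategory.Bounded.ι.map f) (-j) (by lia)).trans
    (DerivedCategory.Bounded.ι.map_zero ((single A j).obj X) ((single A k).obj I)).symm

lemma derivedCategory_hom_single_eq_zero (hA : IsHereditary A) {X Y : A} {j k : ℤ} (h : j + 2 ≤ k)
    (f : (DerivedCategory.singleFunctor A (-j)).obj X ⟶
      (DerivedCategory.singleFunctor A (-k)).obj Y) : f = 0 := by
  have : HasExt.{w} A := hasExt_of_hasDerivedCategory A
  obtain ⟨n, hn⟩ : ∃ n : ℕ, (n : ℤ) = k - j := ⟨(k - j).toNat, by lia⟩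
  have := hA X
  have := HasProjectiveDimensionLT.subsingleton.{w} X 2 n (by lia) Y
  have h₁ := (Abelian.Ext.homEquiv (X := X) (Y := Y) (n := n)).symm.subsingleton
  let eX := ((DerivedCategory.singleFunctors A).shiftIso (-j) 0 (-j) (by simp)).app X
  let eY := ((DerivedCategory.singleFunctors A).shiftIso (-j) (-n) (-k) (by lia)).app Y
  let eY' := ((DerivedCategory.singleFunctors A).shiftIso (n : ℤ) (-n) 0 (by lia)).app Y
  have h₂ : eX.inv ≫ f⟦-j⟧' ≫ eY.hom ≫ eY'.inv = 0 := h₁.elim _ _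
  rw [Preadditive.IsIso.comp_left_eq_zero] at h₂
  rw [← Category.assoc, Preadditive.IsIso.comp_right_eq_zero,
    Preadditive.IsIso.comp_right_eq_zero] at h₂
  exact (shiftFunctor _ (-j)).map_injective (h₂.trans ((shiftFunctor _ (-j)).map_zero _ _).symm)

lemma hom_single_eq_zero_of_isHereditary (hA : IsHereditary A) {X Y : A} {j k : ℤ} (h : j + 2 ≤ k)
    (f : (single A j).obj X ⟶ (single A k).obj Y) : f = 0 :=
  DerivedCategory.Bounded.ι.map_injective ((derivedCategory_hom_single_eq_zero hA h
    (DerivedCategory.Bounded.ι.map f)).trans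
    (DerivedCategory.Bounded.ι.map_zero ((single A j).obj X) ((single A k).obj Y)).symm)

end Vanishing

/-! ### Homology of distinguished triangles -/

section Homology

variable {A : Type u} [Category.{v} A] [Abelian A] [HasDerivedCategory.{w} A]
  (T : Triangle (DerivedCategory.Bounded A)) (hT : T ∈ distTriang (DerivedCategory.Bounded A))

include hT

lemma epi_homology_map_mor₁ (k : ℤ) (h : IsZero ((homology k).obj T.obj₃)) :
    Epi ((homology k).map T.mor₁) :=
  ((homology k).map_distinguished_exact T hT).epi_f (h.eq_of_tgt _ _)

lemma mono_homology_map_mor₂ (k : ℤ) (h : IsZero ((homology k).obj T.obj₁)) :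
    Mono ((homology k).map T.mor₂) :=
  ((homology k).map_distinguished_exact T hT).mono_g (h.eq_of_src _ _)

lemma isZero_homology_obj₂ (k : ℤ) (h₁ : IsZero ((homology k).obj T.obj₁))
    (h₃ : IsZero ((homology k).obj T.obj₃)) : IsZero ((homology k).obj T.obj₂) :=
  ((homology k).map_distinguished_exact T hT).isZero_of_both_isZero h₁ h₃

lemma isIso_homology_map_mor₂ (k k' : ℤ) (hk : k + 1 = k') (h₁ : IsZero ((homology k').obj T.obj₁))
    (h₁' : IsZero ((homology k).obj T.obj₁)) : IsIso ((homology k').map T.mor₂) := by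
  have := mono_homology_map_mor₂ T hT k' h₁
  have : Epi ((homology k').map T.mor₂) := epi_homology_map_mor₁ _ (rot_of_distTriang _ hT) k'
    (h₁'.of_iso (homologyShiftIso _ k k' hk))
  exact isIso_of_mono_of_epi _

lemma isIso_homology_map_mor₁ (k k' : ℤ) (hk : k + 1 = k') (h₃ : IsZero ((homology k).obj T.obj₃))
    (h₃' : IsZero ((homology k').obj T.obj₃)) : IsIso ((homology k).map T.mor₁) := by
  have := epi_homology_map_mor₁ T hT k h₃
  have : Mono ((homology k).map T.mor₁) := mono_homology_map_mor₂ _ (inv_rot_of_distTriang _ hT) k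
    (h₃'.of_iso ((homologyShiftIso _ k k' hk).symm ≪≫
      (homology k').mapIso ((shiftEquiv _ (1 : ℤ)).counitIso.app _)))
  exact isIso_of_mono_of_epi _

end Homology

/-! ### Dévissage and splitting in the hereditary case -/

section Devissage

variable {A : Type u} [Category.{v} A] [Abelian A] [HasDerivedCategory.{w} A]

/-- Induction on the cohomological amplitude, truncating off the lowest cohomological degree. The
bounds in `hP` are kept because they force the connecting morphism to vanish in the hereditary case.
-/
lemma devissage (P : ObjectProperty (DerivedCategory.Bounded A)) [P.IsClosedUnderIsomorphisms]
    (h0 : ∀ X, IsZero X → P X)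
    (hP : ∀ T ∈ distTriang (DerivedCategory.Bounded A), ∀ (k : ℤ),
      (canonical A).IsGE T.obj₁ (-k) → (canonical A).IsLE T.obj₁ (-k) →
      (canonical A).IsGE T.obj₃ (-k + 1) → P T.obj₁ → P T.obj₃ → P T.obj₂)
    (X : DerivedCategory.Bounded A) (hX : ∀ k, P ((single A k).obj ((homology k).obj X))) :
    P X := by
  suffices this' : ∀ (n : ℕ) (a : ℤ) (X : DerivedCategory.Bounded A), (canonical A).IsGE X a →
      (canonical A).IsLE X (a + n - 1) → (∀ k, P ((single A k).obj ((homology k).obj X))) → P X by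
    obtain ⟨⟨a, ha⟩, ⟨b, hb⟩⟩ := X.property
    have : (canonical A).IsGE X a := by rwa [ObjectProperty.tStructure_isGE_iff]
    have : (canonical A).IsLE X b := by rwa [ObjectProperty.tStructure_isLE_iff]
    exact this' (b - a + 1).toNat a X ‹_› ((canonical A).isLE_of_le _ b _ (by lia)) hX
  intro n
  induction n with
  | zero =>
    intro a X _ _ _
    exact h0 _ ((canonical A).isZero X (a + (0 : ℕ) - 1) a (by lia))
  | succ n hn =>
    intro a X _ hX' hX
    obtain ⟨X₁, X₃, h₁, h₃, f, g, δ, hT⟩ := (canonical A).exists_triangle X a (a + 1) rfl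
    have h₁ : (canonical A).IsLE X₁ a := ⟨h₁⟩
    have h₃ : (canonical A).IsGE X₃ (a + 1) := ⟨h₃⟩
    have hs₃ := (canonical A).isGE_shift X₃ (a + 1) (-1) (a + 2) (by lia)
    have hs₁ := (canonical A).isLE_shift X₁ a 1 (a - 1) (by lia)
    have h₁' : (canonical A).IsGE X₁ a :=
      (canonical A).isGE₂ _ (inv_rot_of_distTriang _ hT) a
        ((canonical A).isGE_of_ge (X₃⟦(-1 : ℤ)⟧) a (a + 2) (by lia)) ‹_›
    have h₃' : (canonical A).IsLE X₃ (a + (n + 1 : ℕ) - 1) :=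
      (canonical A).isLE₂ _ (rot_of_distTriang _ hT) _ ‹_›
        ((canonical A).isLE_of_le (X₁⟦(1 : ℤ)⟧) (a - 1) _ (by lia))
    have hX₁ : P X₁ := by
      obtain ⟨e⟩ := exists_iso_single X₁ (-a) (hX := by rwa [neg_neg]) (hX' := by rwa [neg_neg])
      have : IsIso ((homology (-a)).map f) := isIso_homology_map_mor₁ _ hT (-a) (-a + 1) rfl
        ((canonical_isGE_iff _ _).1 h₃ _ (by lia)) ((canonical_isGE_iff _ _).1 h₃ _ (by lia))
      exact P.prop_of_iso ((single A _).mapIso (asIso ((homology (-a)).map f)).symm ≪≫ e.symm)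
        (hX (-a))
    refine hP _ hT (-a) (by rwa [neg_neg]) (by rwa [neg_neg]) (by rwa [neg_neg]) hX₁
      (hn (a + 1) X₃ h₃ (by convert h₃' using 1; push_cast; ring) fun k ↦ ?_)
    by_cases hk : k < -a
    · have : IsIso ((homology k).map g) := isIso_homology_map_mor₂ _ hT (k - 1) k (by lia)
        ((canonical_isLE_iff _ _).1 h₁ _ (by lia)) ((canonical_isLE_iff _ _).1 h₁ _ (by lia))
      exact P.prop_of_iso ((single A _).mapIso (asIso ((homology k).map g))) (hX k)
    · exact h0 _ (Functor.map_isZero _ ((canonical_isGE_iff _ _).1 h₃ _ (by lia)))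

variable (hA : IsHereditary A)
include hA

lemma hom_eq_zero_of_isHereditary {X Y : DerivedCategory.Bounded A} {n m : ℤ}
    (hX : (canonical A).IsGE X n) (hY : (canonical A).IsLE Y m) (hnm : m + 2 ≤ n)
    (f : X ⟶ Y) : f = 0 := by
  let P : ObjectProperty (DerivedCategory.Bounded A) := fun X ↦
    ∀ (k : ℤ) (Z : A), -k ≤ m → ∀ f : X ⟶ (single A k).obj Z, f = 0
  have : P.IsClosedUnderIsomorphisms := ⟨fun e h k Z hk f ↦ by
    simpa using h k Z hk (e.hom ≫ f)⟩
  have hP : P X := by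
    refine devissage P (fun X hX k Z _ f ↦ hX.eq_of_src _ _) ?_ X ?_
    · intro T hT _ _ _ _ h₁ h₃ k Z hk f
      obtain ⟨g, rfl⟩ := T.yoneda_exact₂ hT f (h₁ k Z hk _)
      rw [h₃ k Z hk g, comp_zero]
    · intro j k Z hk f
      by_cases hj : -n < j
      · exact (Functor.map_isZero _ ((canonical_isGE_iff _ _).1 hX _ hj)).eq_of_src _ _
      · exact hom_single_eq_zero_of_isHereditary hA (by lia) f
  let P' : ObjectProperty (DerivedCategory.Bounded A) := fun Y ↦ ∀ f : X ⟶ Y, f = 0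
  have : P'.IsClosedUnderIsomorphisms := ⟨fun e h f ↦ by
    simpa using h (f ≫ e.inv)⟩
  suffices P' Y from this f
  refine devissage P' (fun X hX f ↦ hX.eq_of_tgt _ _) ?_ Y ?_
  · intro T hT _ _ _ _ h₁ h₃ f
    obtain ⟨g, rfl⟩ := T.coyoneda_exact₂ hT f (h₃ _)
    rw [h₁ g, zero_comp]
  · intro k f
    by_cases hk : -k ≤ m
    · exact hP k _ hk f
    · exact (Functor.map_isZero _ ((canonical_isLE_iff _ _).1 hY _ (by lia))).eq_of_tgt _ _

/-- In the hereditary case, every object is built from its homology by split triangles. -/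
lemma split_devissage (P : ObjectProperty (DerivedCategory.Bounded A))
    [P.IsClosedUnderIsomorphisms] (h0 : ∀ X, IsZero X → P X)
    (hP : ∀ T ∈ distTriang (DerivedCategory.Bounded A), T.mor₃ = 0 →
      P T.obj₁ → P T.obj₃ → P T.obj₂)
    (X : DerivedCategory.Bounded A) (hX : ∀ k, P ((single A k).obj ((homology k).obj X))) :
    P X := by
  refine devissage P h0 (fun T hT k _ h₁ h₃ ↦ hP T hT ?_) X hX
  have := (canonical A).isLE_shift T.obj₁ (-k) 1 (-k - 1) (by lia)
  exact hom_eq_zero_of_isHereditary hA h₃ this (by lia) _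

/-- Two truncations isolate degree `k`. Both connecting morphisms cross a gap of two degrees, hence
vanish, so both triangles split. -/
lemma exists_retract_single (X : DerivedCategory.Bounded A) (k : ℤ) :
    ∃ (i : (single A k).obj ((homology k).obj X) ⟶ X)
      (p : X ⟶ (single A k).obj ((homology k).obj X)),
      i ≫ p = 𝟙 _ ∧ IsIso ((homology k).map i) := by
  obtain ⟨X₁, X₃, h₁, h₃, f, g, δ, hT⟩ := (canonical A).exists_triangle X (-k) (-k + 1) rfl
  obtain ⟨Y₁, Y₃, h₁', h₃', f', g', δ', hT'⟩ :=
    (canonical A).exists_triangle X₁ (-k - 1) (-k) (by lia)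
  have h₁ : (canonical A).IsLE X₁ (-k) := ⟨h₁⟩
  have h₃ : (canonical A).IsGE X₃ (-k + 1) := ⟨h₃⟩
  have h₁' : (canonical A).IsLE Y₁ (-k - 1) := ⟨h₁'⟩
  have h₃' : (canonical A).IsGE Y₃ (-k) := ⟨h₃'⟩
  have hs₁ := (canonical A).isLE_shift X₁ (-k) 1 (-k - 1) (by lia)
  have hs₁' := (canonical A).isLE_shift Y₁ (-k - 1) 1 (-k - 2) (by lia)
  have hδ : δ = 0 := hom_eq_zero_of_isHereditary hA h₃ hs₁ (by lia) _
  have hδ' : δ' = 0 := hom_eq_zero_of_isHereditary hA h₃' hs₁' (by lia) _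
  have h₃'' : (canonical A).IsLE Y₃ (-k) :=
    (canonical A).isLE₂ _ (rot_of_distTriang _ hT') _ h₁
      ((canonical A).isLE_of_le (Y₁⟦(1 : ℤ)⟧) (-k - 2) _ (by lia))
  have : Mono f := Triangle.mono₁ _ hT hδ
  have : Epi g' := Triangle.epi₂ _ hT' hδ'
  have : IsSplitMono f := isSplitMono_of_mono f
  have : IsSplitEpi g' := isSplitEpi_of_epi g'
  have : Epi ((homology k).map f) := epi_homology_map_mor₁ _ hT k
    ((canonical_isGE_iff _ _).1 h₃ _ (by lia))
  have : Mono ((homology k).map g') := mono_homology_map_mor₂ _ hT' k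
    ((canonical_isLE_iff _ _).1 h₁' _ (by lia))
  have : IsIso ((homology k).map f) := isIso_of_mono_of_epi _
  have : IsIso ((homology k).map g') := isIso_of_mono_of_epi _
  have : IsIso ((homology k).map (section_ g')) := by
    have : (homology k).map (section_ g') ≫ (homology k).map g' = 𝟙 _ := by
      rw [← Functor.map_comp, IsSplitEpi.id, CategoryTheory.Functor.map_id]
    exact IsIso.of_isIso_fac_right this
  obtain ⟨e⟩ := exists_iso_single Y₃ k
  let e' := e ≪≫ (single A k).mapIso (asIso ((homology k).map (section_ g')) ≪≫
    asIso ((homology k).map f))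
  refine ⟨e'.inv ≫ section_ g' ≫ f, retraction f ≫ g' ≫ e'.hom, by simp, ?_⟩
  rw [Functor.map_comp, Functor.map_comp]
  infer_instance

end Devissage

/-! ### Lifting and extending along distinguished triangles -/

section Triangles

variable {C : Type*} [Category* C] [Preadditive C] [HasZeroObject C] [HasShift C ℤ]
  [∀ (n : ℤ), (shiftFunctor C n).Additive] [Pretriangulated C]
  {X Y Z : C} {f : X ⟶ Y} {g : Y ⟶ Z} {δ : Z ⟶ X⟦(1 : ℤ)⟧}
  (hT : Triangle.mk f g δ ∈ distTriang C)

include hT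

lemma exists_comp_mor₁_eq {W : C} (x : W ⟶ Y) (hx : x ≫ g = 0) : ∃ y : W ⟶ X, y ≫ f = x := by
  obtain ⟨y, hy⟩ := Triangle.coyoneda_exact₂ _ hT x hx
  exact ⟨y, hy.symm⟩

lemma exists_comp_mor₂_eq {W : C} (x : W ⟶ Z) (hx : x ≫ δ = 0) : ∃ y : W ⟶ Y, y ≫ g = x := by
  obtain ⟨y, hy⟩ := Triangle.coyoneda_exact₃ _ hT x hx
  exact ⟨y, hy.symm⟩

lemma exists_comp_mor₃_eq {W : C} (x : W ⟶ X⟦(1 : ℤ)⟧) (hx : x ≫ f⟦(1 : ℤ)⟧' = 0) :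
    ∃ y : W ⟶ Z, y ≫ δ = x := by
  obtain ⟨y, hy⟩ := Triangle.coyoneda_exact₁ _ hT x hx
  exact ⟨y, hy.symm⟩

lemma exists_mor₂_comp_eq {W : C} (x : Y ⟶ W) (hx : f ≫ x = 0) : ∃ y : Z ⟶ W, g ≫ y = x := by
  obtain ⟨y, hy⟩ := Triangle.yoneda_exact₂ _ hT x hx
  exact ⟨y, hy.symm⟩

lemma exists_mor₃_comp_eq {W : C} (x : Z ⟶ W) (hx : g ≫ x = 0) :
    ∃ y : X⟦(1 : ℤ)⟧ ⟶ W, δ ≫ y = x := by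
  obtain ⟨y, hy⟩ := Triangle.yoneda_exact₃ _ hT x hx
  exact ⟨y, hy.symm⟩

lemma exists_comp_invRotate_eq {W : C} (x : W ⟶ X) (hx : x ≫ f = 0) :
    ∃ (y : W ⟶ Z⟦(-1 : ℤ)⟧) (d : Z⟦(-1 : ℤ)⟧ ⟶ X), y ≫ d = x := by
  obtain ⟨y, hy⟩ := Triangle.coyoneda_exact₂ _ (inv_rot_of_distTriang _ hT) x hx
  exact ⟨y, _, hy.symm⟩

lemma exists_mor₁_comp_eq {W : C} (x : X ⟶ W) (hx : δ ≫ x⟦(1 : ℤ)⟧' = 0) :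
    ∃ y : Y ⟶ W, f ≫ y = x := by
  obtain ⟨y, hy, _⟩ := complete_distinguished_triangle_morphism₂ _ _ hT
    (contractible_distinguished W) x 0 (hx.trans zero_comp.symm)
  exact ⟨y, hy.trans (Category.comp_id x)⟩

lemma exists_comp_shift_mor₂_eq {W : C} (x : W ⟶ Z⟦(1 : ℤ)⟧)
    (hx : x ≫ δ⟦(1 : ℤ)⟧' = 0) : ∃ y : W ⟶ Y⟦(1 : ℤ)⟧, y ≫ g⟦(1 : ℤ)⟧' = x := by
  obtain ⟨y, hy⟩ := Triangle.coyoneda_exact₃ _ (rot_of_distTriang _ (rot_of_distTriang _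
    (rot_of_distTriang _ hT))) x ((Preadditive.comp_neg _ _).trans (neg_eq_zero.2 hx))
  exact ⟨-y, (Preadditive.neg_comp_neg (-y) _).symm.trans
    ((congrArg (· ≫ _) (neg_neg y)).trans hy.symm)⟩

end Triangles

/-! ### Five-term exact sequences -/

section FiveTerms

variable {A : Type u} [Category.{v} A] [Abelian A]

/-- This separates the five-term axiom into a cokernel, a kernel and an extension. -/
lemma exists_shortExact_of_exact {X₁ X₂ X₃ X₄ X₅ : A}
    (f₁ : X₁ ⟶ X₂) (f₂ : X₂ ⟶ X₃) (f₃ : X₃ ⟶ X₄) (f₄ : X₄ ⟶ X₅)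
    (exact : (ComposableArrows.mk₄ f₁ f₂ f₃ f₄).Exact) :
    ∃ (g : cokernel f₁ ⟶ X₃) (h : X₃ ⟶ kernel f₄) (w : g ≫ h = 0),
      (ShortComplex.mk g h w).ShortExact := by
  have w₁ : f₁ ≫ f₂ = 0 := exact.toIsComplex.zero 0
  have w₂ : f₂ ≫ f₃ = 0 := exact.toIsComplex.zero 1
  have w₃ : f₃ ≫ f₄ = 0 := exact.toIsComplex.zero 2
  have e₁ : (ShortComplex.mk f₁ f₂ w₁).Exact := exact.exact 0
  have e₂ : (ShortComplex.mk f₂ f₃ w₂).Exact := exact.exact 1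
  have e₃ : (ShortComplex.mk f₃ f₄ w₃).Exact := exact.exact 2
  have : Mono (cokernel.desc f₁ f₂ w₁) := e₁.mono_cokernelDesc
  have : Epi (kernel.lift f₄ f₃ w₃) := e₃.epi_kernelLift
  have w : cokernel.desc f₁ f₂ w₁ ≫ f₃ = 0 := by simp [← cancel_epi (cokernel.π f₁), w₂]
  have w' : cokernel.desc f₁ f₂ w₁ ≫ kernel.lift f₄ f₃ w₃ = 0 := by
    simp [← cancel_mono (kernel.ι f₄), w]
  refine ⟨cokernel.desc f₁ f₂ w₁, kernel.lift f₄ f₃ w₃, w', ⟨?_⟩⟩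
  let φ : ShortComplex.mk f₂ f₃ w₂ ⟶ ShortComplex.mk _ _ w :=
    { τ₁ := cokernel.π f₁
      τ₂ := 𝟙 _
      τ₃ := 𝟙 _ }
  let ψ : ShortComplex.mk _ _ w' ⟶ ShortComplex.mk _ _ w :=
    { τ₁ := 𝟙 _
      τ₂ := 𝟙 _
      τ₃ := kernel.ι f₄ }
  have : Epi φ.τ₁ := inferInstanceAs (Epi (cokernel.π f₁))
  have : IsIso φ.τ₂ := inferInstanceAs (IsIso (𝟙 _))
  have : Mono φ.τ₃ := inferInstanceAs (Mono (𝟙 _))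
  have : Epi ψ.τ₁ := inferInstanceAs (Epi (𝟙 _))
  have : IsIso ψ.τ₂ := inferInstanceAs (IsIso (𝟙 _))
  have : Mono ψ.τ₃ := inferInstanceAs (Mono (kernel.ι f₄))
  exact (ShortComplex.exact_iff_of_epi_of_isIso_of_mono ψ).2
    ((ShortComplex.exact_iff_of_epi_of_isIso_of_mono φ).1 e₂)

lemma exact_mk₄ {X₁ X₂ X₃ X₄ X₅ : A}
    {f₁ : X₁ ⟶ X₂} {f₂ : X₂ ⟶ X₃} {f₃ : X₃ ⟶ X₄} {f₄ : X₄ ⟶ X₅}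
    {w₁ : f₁ ≫ f₂ = 0} {w₂ : f₂ ≫ f₃ = 0} {w₃ : f₃ ≫ f₄ = 0}
    (e₁ : (ShortComplex.mk f₁ f₂ w₁).Exact) (e₂ : (ShortComplex.mk f₂ f₃ w₂).Exact)
    (e₃ : (ShortComplex.mk f₃ f₄ w₃).Exact) : (ComposableArrows.mk₄ f₁ f₂ f₃ f₄).Exact :=
  ComposableArrows.exact_of_δ₀ e₁.exact_toComposableArrows
    (ComposableArrows.exact_of_δ₀ e₂.exact_toComposableArrows e₃.exact_toComposableArrows)

end FiveTerms

/-! ### Coreflections, object by object -/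

section Coreflection

variable {A : Type u} [Category.{v} A]

/-- A morphism `ε : T ⟶ M` is a coreflection of `M` in `P` if `T` satisfies `P` and every morphism
to `M` from an object satisfying `P` factors uniquely through `ε`. -/
structure IsCoreflection (P : ObjectProperty A) {T M : A} (ε : T ⟶ M) : Prop where
  prop : P T
  exists_lift {X : A} (hX : P X) (f : X ⟶ M) : ∃ g, g ≫ ε = f
  hom_ext {X : A} (hX : P X) {f g : X ⟶ T} (h : f ≫ ε = g ≫ ε) : f = g

lemma isLeftAdjoint_ι_iff (P : ObjectProperty A) :
    P.ι.IsLeftAdjoint ↔ ∀ M, ∃ (T : A) (ε : T ⟶ M), IsCoreflection P ε := by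
  constructor
  · intro _ M
    let adj := Adjunction.ofIsLeftAdjoint P.ι
    refine ⟨_, adj.counit.app M, ((Functor.rightAdjoint P.ι).obj M).property, fun {X} hX f ↦
      ⟨(adj.homEquiv ⟨X, hX⟩ M f).hom, ?_⟩, fun {X} hX f g h ↦ ?_⟩
    · have := adj.homEquiv_counit (X := ⟨X, hX⟩) (Y := M) (g := adj.homEquiv ⟨X, hX⟩ M f)
      rw [Equiv.symm_apply_apply] at this
      exact this.symm
    · have : (P.homMk f : (⟨X, hX⟩ : P.FullSubcategory) ⟶ _) = P.homMk g := by
        apply (adj.homEquiv ⟨X, hX⟩ M).symm.injective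
        rw [adj.homEquiv_counit, adj.homEquiv_counit]
        exact h
      exact congrArg InducedCategory.Hom.hom this
  · intro h
    rw [isLeftAdjoint_iff_hasTerminal_costructuredArrow]
    intro M
    obtain ⟨T, ε, hε⟩ := h M
    let T' : P.FullSubcategory := ⟨T, hε.prop⟩
    let ε' : P.ι.obj T' ⟶ M := ε
    have hl (W : CostructuredArrow P.ι M) : ∃ l : W.left ⟶ T', P.ι.map l ≫ ε' = W.hom := by
      obtain ⟨l, hl⟩ := hε.exists_lift W.left.property W.hom
      exact ⟨P.homMk l, hl⟩
    choose l hl using hl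
    let Z : CostructuredArrow P.ι M := CostructuredArrow.mk ε'
    exact IsTerminal.hasTerminal (X := Z) (IsTerminal.ofUniqueHom
      (fun W ↦ CostructuredArrow.homMk (l W) (hl W))
      (fun W m ↦ by
        ext
        exact hε.hom_ext W.left.property ((CostructuredArrow.w m).trans (hl W).symm)))

end Coreflection

/-! ### From t-structures to coreflective narrow sequences -/

section

variable {A : Type u} [Category.{v} A] [Abelian A] [HasDerivedCategory.{w} A]

lemma single_hom_ext {M M' : A} {k : ℤ} {f g : (single A k).obj M ⟶ (single A k).obj M'}
    (h : (homology k).map f = (homology k).map g) : f = g := by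
  obtain ⟨f, rfl⟩ := (single A k).map_surjective f
  obtain ⟨g, rfl⟩ := (single A k).map_surjective g
  congr 1
  have h₁ := NatIso.naturality_1 (singleHomologyIso A k) f
  have h₂ := NatIso.naturality_1 (singleHomologyIso A k) g
  dsimp at h₁ h₂
  rw [← h₁, ← h₂, h]

variable (hA : IsHereditary A) (t : TStructure (DerivedCategory.Bounded A))

lemma le_zero_shift {X : DerivedCategory.Bounded A} (hX : t.le 0 X) :
    t.le 0 (X⟦(1 : ℤ)⟧) :=
  t.le_monotone (by lia) _ (t.le_shift 0 1 (-1) (by lia) X hX)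

lemma le_zero_ext (T : Triangle (DerivedCategory.Bounded A)) (hT : T ∈ distTriang _)
    (h₁ : t.le 0 T.obj₁) (h₃ : t.le 0 T.obj₃) : t.le 0 T.obj₂ :=
  (t.isLE₂ T hT 0 ⟨h₁⟩ ⟨h₃⟩).le

lemma le_zero_of_retract {X Y : DerivedCategory.Bounded A} (i : Y ⟶ X) (p : X ⟶ Y)
    (h : i ≫ p = 𝟙 Y) (hX : t.le 0 X) : t.le 0 Y := by
  have : t.IsLE X 0 := ⟨hX⟩
  suffices t.IsLE Y 0 from this.le
  rw [t.isLE_iff_orthogonal 0 1 (by lia)]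
  intro Z f _
  rw [← Category.id_comp f, ← h, Category.assoc, t.zero (p ≫ f) 0 1, comp_zero]

include hA

lemma le_zero_single_homology {X : DerivedCategory.Bounded A} (hX : t.le 0 X) (k : ℤ) :
    t.le 0 ((single A k).obj ((homology k).obj X)) := by
  obtain ⟨i, p, h, _⟩ := exists_retract_single hA X k
  exact le_zero_of_retract t i p h hX

lemma mu_iff (k : ℤ) (M : A) : mu (t.le 0) k M ↔ t.le 0 ((single A k).obj M) := by
  constructor
  · rintro ⟨X, hX, ⟨e⟩⟩
    exact (t.le 0).prop_of_iso ((single A k).mapIso e) (le_zero_single_homology hA t hX k)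
  · intro h
    exact ⟨_, h, ⟨(singleHomologyIso A k).app M⟩⟩

lemma theta_mu : theta (mu (t.le 0)) = t.le 0 := by
  ext X
  refine ⟨fun h ↦ ?_, fun h k ↦ ⟨X, h, ⟨Iso.refl _⟩⟩⟩
  refine split_devissage hA _ (fun X hX ↦ ?_)
    (fun T hT _ h₁ h₃ ↦ le_zero_ext t T hT h₁ h₃) X (fun k ↦ (mu_iff hA t k _).1 (h k))
  rw [TStructure.le_iff_isLE, t.isLE_iff_orthogonal 0 1 (by lia)]
  exact fun Y f _ ↦ hX.eq_of_src _ _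

lemma mu_le_succ (k : ℤ) : mu (t.le 0) k ≤ mu (t.le 0) (k + 1) := fun M hM ↦ by
  rw [mu_iff hA] at hM ⊢
  exact (t.le 0).prop_of_iso (singleShiftIso M k (k + 1)) (le_zero_shift t hM)

lemma mu_shortExact {S : ShortComplex A} (hS : S.ShortExact) {k : ℤ}
    (h₁ : mu (t.le 0) k S.X₁) (h₃ : mu (t.le 0) k S.X₃) : mu (t.le 0) k S.X₂ := by
  rw [mu_iff hA] at *
  obtain ⟨δ, hδ⟩ := exists_triangle_of_shortExact hS k
  exact le_zero_ext t _ hδ h₁ h₃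

/-- The cone of `f` in degree `k` is an extension of `M` in degree `k + 1` by `M'` in degree `k`,
and its `H_k` is the cokernel. `mu_kernel` argues dually with the fibre. -/
lemma mu_of_isColimit {k : ℤ} {M M' : A} {f : M ⟶ M'} {c : CokernelCofork f} (hc : IsColimit c)
    (h : mu (t.le 0) (k + 1) M) (h' : mu (t.le 0) k M') : mu (t.le 0) k c.pt := by
  obtain ⟨C, g, δ, hT⟩ := distinguished_cocone_triangle ((single A k).map f)
  rw [mu_iff hA] at h h'
  have hC : t.le 0 C := le_zero_ext t _ (rot_of_distTriang _ hT) h'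
    ((t.le 0).prop_of_iso (singleShiftIso M k (k + 1)).symm h)
  have hE := (homology k).map_distinguished_exact _ hT
  have : Epi ((homology k).map g) := epi_homology_map_mor₁ _ (rot_of_distTriang _ hT) k
    ((isZero_homology_single M k (k + 1) (by lia)).of_iso
      ((homology k).mapIso (singleShiftIso M k (k + 1))))
  have : Epi ((shortComplexOfDistTriangle _ hT).map (homology k)).g := this
  have e : cokernel ((homology k).map ((single A k).map f)) ≅ cokernel f :=
    cokernel.mapIso _ _ ((singleHomologyIso A k).app M) ((singleHomologyIso A k).app M')
      ((singleHomologyIso A k).hom.naturality f)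
  exact ⟨C, hC, ⟨hE.gIsCokernel.coconePointUniqueUpToIso (cokernelIsCokernel _) ≪≫ e ≪≫
    (cokernelIsCokernel f).coconePointUniqueUpToIso hc⟩⟩

lemma mu_kernel {k : ℤ} {M M' : A} (f : M ⟶ M')
    (h : mu (t.le 0) k M) (h' : mu (t.le 0) (k - 1) M') : mu (t.le 0) k (kernel f) := by
  obtain ⟨C, g, δ, hT⟩ := distinguished_cocone_triangle₁ ((single A k).map f)
  rw [mu_iff hA] at h h'
  let e : ((single A k).obj M')⟦(-1 : ℤ)⟧ ≅ (single A (k - 1)).obj M' :=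
    (shiftFunctor _ (-1 : ℤ)).mapIso (singleShiftIso M' (k - 1) k).symm ≪≫
      (shiftEquiv _ (1 : ℤ)).unitIso.symm.app _
  have hC : t.le 0 C := le_zero_ext t _ (inv_rot_of_distTriang _ hT)
    ((t.le 0).prop_of_iso e.symm h') h
  have hE := (homology k).map_distinguished_exact _ hT
  have : Mono ((homology k).map g) := mono_homology_map_mor₂ _ (inv_rot_of_distTriang _ hT) k
    ((isZero_homology_single M' k (k - 1) (by lia)).of_iso ((homology k).mapIso e))
  have : Mono ((shortComplexOfDistTriangle _ hT).map (homology k)).f := this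
  have e : kernel ((homology k).map ((single A k).map f)) ≅ kernel f :=
    kernel.mapIso _ _ ((singleHomologyIso A k).app M) ((singleHomologyIso A k).app M')
      ((singleHomologyIso A k).hom.naturality f)
  exact ⟨C, hC, ⟨hE.fIsKernel.conePointUniqueUpToIso (kernelIsKernel _) ≪≫ e⟩⟩

/-- If `X` is the aisle part of `M` in degree `k`, then `H_k X ⟶ M` is the coreflection: morphisms
lift because `Y` is in `t.ge 1`, uniquely because `Y⟦-1⟧` is in `t.ge 2`. -/
lemma exists_isCoreflection_mu (k : ℤ) (M : A) :
    ∃ (T : A) (ε : T ⟶ M), IsCoreflection (mu (t.le 0) k) ε := by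
  obtain ⟨X, Y, hX, hY, u, v, δ, hT⟩ := t.exists_triangle_zero_one ((single A k).obj M)
  obtain ⟨i, p, hip, _⟩ := exists_retract_single hA X k
  obtain ⟨ε, hε⟩ := (single A k).map_surjective (i ≫ u)
  have : IsSplitMono i := ⟨⟨p, hip⟩⟩
  have hpi : (homology k).map p ≫ (homology k).map i = 𝟙 _ := by
    rw [← cancel_epi ((homology k).map i), ← Category.assoc, ← Functor.map_comp, hip]
    simp
  refine ⟨_, ε, ⟨X, hX, ⟨Iso.refl _⟩⟩, fun {L} hL f ↦ ?_, fun {L} hL f g h ↦ ?_⟩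
  · rw [mu_iff hA] at hL
    obtain ⟨g, hg⟩ := exists_comp_mor₁_eq hT ((single A k).map f) (t.zero' _ hL hY)
    obtain ⟨g', hg'⟩ := (single A k).map_surjective (g ≫ p)
    refine ⟨g', (single A k).map_injective ?_⟩
    -- `p ≫ i` is not the identity of `X` in general, but it is on `H_k`, which suffices between
    -- objects in degree `k`.
    apply single_hom_ext
    rw [Functor.map_comp, hε, hg', ← hg]
    simp [reassoc_of% hpi]
  · rw [mu_iff hA] at hL
    apply (single A k).map_injective
    rw [← cancel_mono i, ← sub_eq_zero, ← Preadditive.sub_comp]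
    obtain ⟨z, d, hz⟩ := exists_comp_invRotate_eq hT
      (((single A k).map f - (single A k).map g) ≫ i) (by
        rw [Category.assoc, ← hε, Preadditive.sub_comp, ← Functor.map_comp, ← Functor.map_comp, h,
          sub_self])
    have : z = 0 := t.zero_of_isLE_of_isGE z 0 2 (by lia) ⟨hL⟩
      ⟨t.ge_shift 1 (-1) 2 (by lia) _ hY⟩
    rw [← hz, this, zero_comp]

lemma isCoreflectiveNarrowSequence_mu : IsCoreflectiveNarrowSequence (mu (t.le 0)) where
  isNarrow k :=
    { isClosedUnderIsomorphisms := by dsimp [mu]; infer_instance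
      isClosedUnderExtensions := ⟨fun hS ↦ mu_shortExact hA t hS⟩
      isClosedUnderCokernels := ⟨by
        rintro _ ⟨f, c, hc, hf⟩
        exact mu_of_isColimit hA t hc (mu_le_succ hA t k _ hf.1) hf.2⟩ }
  le_succ := mu_le_succ hA t
  prop_of_exact k {X₁ X₂ X₃ X₄ X₅} f₁ f₂ f₃ f₄ exact h₁ h₂ h₄ h₅ := by
    obtain ⟨g, h, w, hS⟩ := exists_shortExact_of_exact f₁ f₂ f₃ f₄ exact
    have := mu_of_isColimit hA t (cokernelIsCokernel f₁) h₁ h₂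
    exact mu_shortExact hA t hS this (mu_kernel hA t f₄ h₄ h₅)
  isLeftAdjoint_ι k := (isLeftAdjoint_ι_iff _).2 (exists_isCoreflection_mu hA t k)

end

/-! ### Consequences of the narrow axioms inside `A` -/

section AbelianPart

variable {A : Type u} [Category.{v} A] [Abelian A] {N : ℤ → ObjectProperty A}
  (hN : IsCoreflectiveNarrowSequence N)

include hN

lemma exists_isCoreflection (k : ℤ) (M : A) : ∃ (T : A) (ε : T ⟶ M), IsCoreflection (N k) ε :=
  (isLeftAdjoint_ι_iff _).1 (hN.isLeftAdjoint_ι k) M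

lemma isClosedUnderIsomorphisms (k : ℤ) : (N k).IsClosedUnderIsomorphisms :=
  (hN.isNarrow k).isClosedUnderIsomorphisms

/-- Coreflectivity makes `N k` nonempty; zero is then the cokernel of an identity. -/
lemma prop_of_isZero (k : ℤ) {Z : A} (hZ : IsZero Z) : N k Z := by
  obtain ⟨T, ε, hε⟩ := exists_isCoreflection hN k Z
  have := (hN.isNarrow k).isClosedUnderCokernels
  have := isClosedUnderIsomorphisms hN k
  exact (N k).prop_of_iso ((isZero_cokernel_of_epi (𝟙 T)).iso hZ)
    ((N k).prop_cokernel (𝟙 T) hε.prop hε.prop)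

open ZeroObject

lemma prop_cokernel {k : ℤ} {X Y : A} (f : X ⟶ Y) (hX : N (k + 1) X) (hY : N k Y) :
    N k (cokernel f) := by
  have h₀ (j : ℤ) : N j (0 : A) := prop_of_isZero hN j (isZero_zero A)
  refine hN.prop_of_exact k f (cokernel.π f) (0 : _ ⟶ (0 : A)) (0 : (0 : A) ⟶ (0 : A)) ?_
    hX hY (h₀ _) (h₀ _)
  refine exact_mk₄ (w₁ := by simp) (w₂ := by simp) (w₃ := by simp)
    (ShortComplex.exact_cokernel f) ?_ ?_
  · exact (ShortComplex.exact_iff_epi _ rfl).2 inferInstance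
  · exact (ShortComplex.exact_iff_epi _ rfl).2 inferInstance

lemma prop_kernel {k : ℤ} {X Y : A} (f : X ⟶ Y) (hX : N (k + 1) X) (hY : N k Y) :
    N (k + 1) (kernel f) := by
  have h₀ (j : ℤ) : N j (0 : A) := prop_of_isZero hN j (isZero_zero A)
  refine hN.prop_of_exact (k + 1) (0 : (0 : A) ⟶ (0 : A)) (0 : (0 : A) ⟶ _) (kernel.ι f) f ?_
    (h₀ _) (h₀ _) hX (by rwa [add_sub_cancel_right])
  refine exact_mk₄ (w₁ := by simp) (w₂ := by simp) (w₃ := by simp) ?_ ?_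
    (ShortComplex.exact_kernel f)
  · exact (ShortComplex.exact_iff_mono _ rfl).2 inferInstance
  · exact (ShortComplex.exact_iff_mono _ rfl).2 inferInstance

/-- `ε` factors through `cokernel f`, which is in `N k`; the lift of this factorization to `T` is a
retraction of `cokernel.π f`. -/
lemma eq_zero_of_comp_coreflection {k : ℤ} {T M X : A} {ε : T ⟶ M}
    (hε : IsCoreflection (N k) ε) (hX : N (k + 1) X) (f : X ⟶ T) (h : f ≫ ε = 0) : f = 0 := by
  obtain ⟨e, he⟩ := hε.exists_lift (prop_cokernel hN f hX hε.prop) (cokernel.desc f ε h)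
  have : cokernel.π f ≫ e = 𝟙 T := hε.hom_ext hε.prop (by simp [he])
  rw [← Category.comp_id f, ← this, cokernel.condition_assoc, zero_comp]

end AbelianPart

/-! ### Closure properties of `theta N` and of approximable objects -/

section Theta

open ZeroObject

variable {A : Type u} [Category.{v} A] [Abelian A] [HasDerivedCategory.{w} A]
  {N : ℤ → ObjectProperty A} (hN : IsCoreflectiveNarrowSequence N)

include hN

lemma isClosedUnderIsomorphisms_theta : (theta N).IsClosedUnderIsomorphisms where
  of_iso e h k := by
    have := isClosedUnderIsomorphisms hN k
    exact (N k).prop_of_iso ((homology k).mapIso e) (h k)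

lemma theta_single {k : ℤ} {M : A} (hM : N k M) : theta N ((single A k).obj M) := by
  intro j
  by_cases h : j = k
  · subst h
    have := isClosedUnderIsomorphisms hN j
    exact (N j).prop_of_iso ((singleHomologyIso A j).app M).symm hM
  · exact prop_of_isZero hN j (isZero_homology_single M j k h)

lemma theta_shift {X : DerivedCategory.Bounded A} (hX : theta N X) :
    theta N (X⟦(1 : ℤ)⟧) := by
  intro k
  have := isClosedUnderIsomorphisms hN k
  refine (N k).prop_of_iso (homologyShiftIso X (k - 1) k).symm ?_
  have := hN.le_succ (k - 1) _ (hX (k - 1))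
  rwa [sub_add_cancel] at this

lemma theta_ext (T : Triangle (DerivedCategory.Bounded A)) (hT : T ∈ distTriang _)
    (h₁ : theta N T.obj₁) (h₃ : theta N T.obj₃) : theta N T.obj₂ := by
  intro k
  have := isClosedUnderIsomorphisms hN (k + 1)
  have := isClosedUnderIsomorphisms hN (k - 1)
  refine hN.prop_of_exact k _ _ _ _ (exact_mk₄
    ((homology k).map_distinguished_exact _ (inv_rot_of_distTriang _ hT))
    ((homology k).map_distinguished_exact _ hT)
    ((homology k).map_distinguished_exact _ (rot_of_distTriang _ hT))) ?_ (h₁ k) (h₃ k) ?_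
  · exact (N (k + 1)).prop_of_iso ((homology (k + 1)).mapIso
      ((shiftEquiv _ (1 : ℤ)).counitIso.symm.app _) ≪≫ homologyShiftIso _ k (k + 1)) (h₃ (k + 1))
  · exact (N (k - 1)).prop_of_iso (homologyShiftIso _ (k - 1) k).symm (h₁ (k - 1))

lemma isTriangulatedClosed₂_theta : (theta N).IsTriangulatedClosed₂ := by
  have := isClosedUnderIsomorphisms_theta hN
  exact .mk' (theta_ext hN)

lemma theta_of_isZero {X : DerivedCategory.Bounded A} (hX : IsZero X) : theta N X :=
  fun k ↦ prop_of_isZero hN k (Functor.map_isZero _ hX)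

omit hN in
lemma rightOrthogonal_theta {Y : DerivedCategory.Bounded A}
    (h : ∀ (k : ℤ) (M : A), N k M → ∀ f : (single A k).obj M ⟶ Y, f = 0) :
    (theta N).rightOrthogonal Y := by
  intro X f hX
  let P : ObjectProperty (DerivedCategory.Bounded A) := fun X ↦ ∀ f : X ⟶ Y, f = 0
  have : P.IsClosedUnderIsomorphisms := ⟨fun e h f ↦ by simpa using h (e.hom ≫ f)⟩
  refine devissage P (fun X hX f ↦ hX.eq_of_src _ _) ?_ X (fun k ↦ h k _ (hX k)) f
  intro T hT _ _ _ _ h₁ h₃ f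
  obtain ⟨g, rfl⟩ := T.yoneda_exact₂ hT f (h₁ _)
  rw [h₃ g, comp_zero]

/-- The objects `X` that fit in a distinguished triangle `U ⟶ X ⟶ V ⟶ U⟦1⟧` with `U` in `theta N`
and `V` in its right orthogonal. -/
abbrev Approximable (N : ℤ → ObjectProperty A) : ObjectProperty (DerivedCategory.Bounded A) :=
  (theta N).extensionProduct (theta N).rightOrthogonal

lemma approximable_of_rightOrthogonal {X : DerivedCategory.Bounded A}
    (hX : (theta N).rightOrthogonal X) : Approximable N X := by
  have : (theta N).ContainsZero := ⟨⟨0, isZero_zero _, theta_of_isZero hN (isZero_zero _)⟩⟩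
  exact ObjectProperty.le_extensionProduct_right _ _ hX

/-- Associativity of the extension product, together with closure of `theta N` under extensions. -/
lemma approximable_of_triangle {X Y Z : DerivedCategory.Bounded A} {f : X ⟶ Y} {g : Y ⟶ Z}
    {δ : Z ⟶ X⟦(1 : ℤ)⟧} (hT : Triangle.mk f g δ ∈ distTriang _) (hX : theta N X)
    (hZ : Approximable N Z) : Approximable N Y := by
  have := isClosedUnderIsomorphisms_theta hN
  have := isTriangulatedClosed₂_theta hN
  have h : (theta N).extensionProduct (Approximable N) Y := ⟨_, _, _, _, _, hT, hX, hZ⟩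
  rw [← ObjectProperty.extensionProduct_assoc] at h
  exact ObjectProperty.monotone_extensionProduct_left _
    (ObjectProperty.extensionProduct_le_of_isTriangulatedClosed₂ le_rfl le_rfl) _ h

lemma approximable_biprod {X₁ X₂ : DerivedCategory.Bounded A} (h₁ : Approximable N X₁)
    (h₂ : Approximable N X₂) : Approximable N (X₁ ⊞ X₂) := by
  obtain ⟨U₁, V₁, u₁, v₁, δ₁, hT₁, hU₁, hV₁⟩ := h₁
  obtain ⟨U₂, V₂, u₂, v₂, δ₂, hT₂, hU₂, hV₂⟩ := h₂
  obtain ⟨C, c, d, hT⟩ := distinguished_cocone_triangle (biprod.map u₁ u₂)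
  refine ⟨_, _, _, _, _, hT, theta_ext hN _ (binaryBiproductTriangle_distinguished U₁ U₂) hU₁ hU₂,
    fun W x hW ↦ ?_⟩
  have hd : d ≫ (biprod.map u₁ u₂)⟦(1 : ℤ)⟧' = 0 := comp_distTriang_mor_zero₃₁ _ hT
  have hc : biprod.map u₁ u₂ ≫ c = 0 := comp_distTriang_mor_zero₁₂ _ hT
  -- Each component of `x ≫ d` lifts to some `Vᵢ`, where it vanishes. So `x` comes from `X₁ ⊞ X₂`,
  -- and then from `U₁ ⊞ U₂`.
  have hx₁ : x ≫ d ≫ (biprod.fst : U₁ ⊞ U₂ ⟶ U₁)⟦(1 : ℤ)⟧' = 0 := by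
    obtain ⟨y, hy⟩ := exists_comp_mor₃_eq hT₁ (x ≫ d ≫ (biprod.fst : U₁ ⊞ U₂ ⟶ U₁)⟦(1 : ℤ)⟧') (by
      rw [Category.assoc, Category.assoc, ← Functor.map_comp, ← biprod.map_fst, Functor.map_comp,
        reassoc_of% hd, zero_comp, comp_zero])
    rw [← hy, hV₁ y hW, zero_comp]
  have hx₂ : x ≫ d ≫ (biprod.snd : U₁ ⊞ U₂ ⟶ U₂)⟦(1 : ℤ)⟧' = 0 := by
    obtain ⟨y, hy⟩ := exists_comp_mor₃_eq hT₂ (x ≫ d ≫ (biprod.snd : U₁ ⊞ U₂ ⟶ U₂)⟦(1 : ℤ)⟧') (by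
      rw [Category.assoc, Category.assoc, ← Functor.map_comp, ← biprod.map_snd, Functor.map_comp,
        reassoc_of% hd, zero_comp, comp_zero])
    rw [← hy, hV₂ y hW, zero_comp]
  have hx : x ≫ d = 0 := by
    have := (shiftFunctor (DerivedCategory.Bounded A) (1 : ℤ)).congr_map
      (biprod.total (X := U₁) (Y := U₂))
    rw [Functor.map_add, Functor.map_comp, Functor.map_comp, CategoryTheory.Functor.map_id] at this
    rw [← Category.comp_id (x ≫ d), ← this, Preadditive.comp_add, Category.assoc, Category.assoc,
      reassoc_of% hx₁, reassoc_of% hx₂, zero_comp, zero_comp, add_zero]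
  obtain ⟨y, rfl⟩ := exists_comp_mor₂_eq hT x hx
  obtain ⟨z₁, hz₁⟩ := exists_comp_mor₁_eq hT₁ (y ≫ biprod.fst) (hV₁ _ hW)
  obtain ⟨z₂, hz₂⟩ := exists_comp_mor₁_eq hT₂ (y ≫ biprod.snd) (hV₂ _ hW)
  have : y = biprod.lift z₁ z₂ ≫ biprod.map u₁ u₂ := by
    apply biprod.hom_ext <;> simp [hz₁, hz₂]
  rw [this, Category.assoc, hc, comp_zero]

lemma approximable_of_homology (hA : IsHereditary A) (X : DerivedCategory.Bounded A)
    (hX : ∀ k, Approximable N ((single A k).obj ((homology k).obj X))) : Approximable N X := by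
  refine split_devissage hA _ (fun X hX ↦ approximable_of_rightOrthogonal hN
    (fun _ f _ ↦ hX.eq_of_tgt _ _)) (fun T hT h h₁ h₃ ↦ ?_) X hX
  obtain ⟨e, _⟩ := exists_iso_binaryBiproduct_of_distTriang T hT h
  exact (Approximable N).prop_of_iso e.symm (approximable_biprod hN h₁ h₃)

end Theta

/-! ### Construction of the truncation triangles -/

section Approximation

variable {A : Type u} [Category.{v} A] [Abelian A] [HasDerivedCategory.{w} A]

lemma hom_single_eq_zero (hA : IsHereditary A) {X Y : A} {i k : ℤ} (h : i ≠ k) (h' : i + 1 ≠ k)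
    (f : (single A i).obj X ⟶ (single A k).obj Y) : f = 0 := by
  obtain h | h : k < i ∨ i + 2 ≤ k := by lia
  · exact hom_single_eq_zero_of_lt h f
  · exact hom_single_eq_zero_of_isHereditary hA h f

lemma hom_single_shift_eq_zero (hA : IsHereditary A) {X Y : A} {i l : ℤ} (h : i ≠ l)
    (h' : i ≠ l + 1) (f : (single A i).obj X ⟶ ((single A l).obj Y)⟦(1 : ℤ)⟧) : f = 0 := by
  rw [← cancel_mono (singleShiftIso Y l (l + 1)).hom, zero_comp]
  exact hom_single_eq_zero hA h' (by lia) _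

lemma hom_single_shift_shift_eq_zero (hA : IsHereditary A) {X Y : A} {l : ℤ}
    (f : (single A l).obj X ⟶ ((single A l).obj Y)⟦(1 : ℤ)⟧⟦(1 : ℤ)⟧) : f = 0 := by
  rw [← cancel_mono ((singleShiftIso Y l (l + 1)).hom⟦(1 : ℤ)⟧'),
    ← cancel_mono (singleShiftIso Y (l + 1) (l + 2)).hom, zero_comp, zero_comp]
  exact hom_single_eq_zero hA (by lia) (by lia) _

lemma hom_single_shift_injective_eq_zero {X I : A} [Injective I] {l : ℤ}
    (f : (single A l).obj X ⟶ ((single A l).obj I)⟦(1 : ℤ)⟧) : f = 0 := by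
  rw [← cancel_mono (singleShiftIso I l (l + 1)).hom, zero_comp]
  exact hom_single_eq_zero_of_injective (by lia) _

/-- If `Ext^2` vanishes, then the vanishing of `Ext^1 (X, -)` is inherited by quotients. -/
lemma hom_single_shift_eq_zero_of_shortExact (hA : IsHereditary A) {S : ShortComplex A}
    (hS : S.ShortExact) {X : A} {l : ℤ}
    (h : ∀ f : (single A l).obj X ⟶ ((single A l).obj S.X₂)⟦(1 : ℤ)⟧, f = 0)
    (f : (single A l).obj X ⟶ ((single A l).obj S.X₃)⟦(1 : ℤ)⟧) : f = 0 := by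
  obtain ⟨δ, hT⟩ := exists_triangle_of_shortExact hS l
  obtain ⟨y, rfl⟩ := exists_comp_shift_mor₂_eq hT f (hom_single_shift_shift_eq_zero hA _)
  rw [h y, zero_comp]

variable {N : ℤ → ObjectProperty A} (hN : IsCoreflectiveNarrowSequence N)

include hN

/-- Coreflections induce injective maps on `Ext^1`. -/
lemma eq_zero_of_comp_shift_coreflection {k : ℤ} {T M X : A} {ε : T ⟶ M}
    (hε : IsCoreflection (N k) ε) (hX : N k X)
    (b : (single A k).obj X ⟶ ((single A k).obj T)⟦(1 : ℤ)⟧)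
    (hb : b ≫ ((single A k).map ε)⟦(1 : ℤ)⟧' = 0) : b = 0 := by
  -- `Y` is the extension of `X` by `T` with class `b`. By `hb`, `ε` extends to `Y`; lifting this
  -- extension through the coreflection splits `i`.
  obtain ⟨Y, i, q, hT⟩ := distinguished_cocone_triangle₂ b
  have hLE := (canonical A).isLE₂ _ hT (-k) (isLE_single T k _ le_rfl) (isLE_single X k _ le_rfl)
  have hGE := (canonical A).isGE₂ _ hT (-k) (isGE_single T k _ le_rfl) (isGE_single X k _ le_rfl)
  have hY : N k ((homology k).obj Y) :=
    theta_ext hN _ hT (theta_single hN hε.prop) (theta_single hN hX) k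
  obtain ⟨e⟩ := exists_iso_single Y k (hX := hGE) (hX' := hLE)
  obtain ⟨g, hg⟩ := exists_mor₁_comp_eq hT ((single A k).map ε) hb
  obtain ⟨i', hi'⟩ := (single A k).map_surjective (i ≫ e.hom)
  obtain ⟨g', hg'⟩ := (single A k).map_surjective (e.inv ≫ g)
  obtain ⟨h, rfl⟩ := hε.exists_lift hY g'
  have hi : i' ≫ h = 𝟙 T := hε.hom_ext hε.prop ((single A k).map_injective (by
    rw [Category.assoc, Functor.map_comp, hi', hg', Category.id_comp]
    simp [hg]))
  have : i ≫ e.hom ≫ (single A k).map h = 𝟙 _ := by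
    rw [← Category.assoc, ← hi', ← Functor.map_comp, hi, CategoryTheory.Functor.map_id]
  have : Mono i := mono_of_mono_fac this
  exact Triangle.mor₃_eq_zero_of_mono₁ _ hT this

lemma hom_single_cone_coreflection_eq_zero {k : ℤ} {T M X : A} {ε : T ⟶ M}
    (hε : IsCoreflection (N k) ε) (hX : N k X) {C : DerivedCategory.Bounded A}
    {g : (single A k).obj M ⟶ C} {δ : C ⟶ ((single A k).obj T)⟦(1 : ℤ)⟧}
    (hT : Triangle.mk ((single A k).map ε) g δ ∈ distTriang _)
    (f : (single A k).obj X ⟶ C) : f = 0 := by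
  have h₃₁ : δ ≫ ((single A k).map ε)⟦(1 : ℤ)⟧' = 0 := comp_distTriang_mor_zero₃₁ _ hT
  have h₁₂ : (single A k).map ε ≫ g = 0 := comp_distTriang_mor_zero₁₂ _ hT
  obtain ⟨y, rfl⟩ := exists_comp_mor₂_eq hT f
    (eq_zero_of_comp_shift_coreflection hN hε hX _ (by rw [Category.assoc, h₃₁, comp_zero]))
  obtain ⟨y, rfl⟩ := (single A k).map_surjective y
  obtain ⟨z, rfl⟩ := hε.exists_lift hX y
  rw [Functor.map_comp, Category.assoc, h₁₂, comp_zero]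

lemma hom_single_succ_cone_coreflection_eq_zero {k : ℤ} {T M X : A} {ε : T ⟶ M}
    (hε : IsCoreflection (N k) ε) (hX : N (k + 1) X) {C : DerivedCategory.Bounded A}
    {g : (single A k).obj M ⟶ C} {δ : C ⟶ ((single A k).obj T)⟦(1 : ℤ)⟧}
    (hT : Triangle.mk ((single A k).map ε) g δ ∈ distTriang _)
    (f : (single A (k + 1)).obj X ⟶ C) : f = 0 := by
  have h₃₁ : δ ≫ ((single A k).map ε)⟦(1 : ℤ)⟧' = 0 := comp_distTriang_mor_zero₃₁ _ hT
  obtain ⟨y, hy⟩ := (shiftFunctor _ (1 : ℤ)).map_surjective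
    ((singleShiftIso X k (k + 1)).hom ≫ f ≫ δ)
  obtain ⟨y, rfl⟩ := (single A k).map_surjective y
  have hy₀ : y = 0 := by
    refine eq_zero_of_comp_coreflection hN hε hX y ((single A k).map_injective
      ((shiftFunctor _ (1 : ℤ)).map_injective ?_))
    rw [Functor.map_comp, Functor.map_comp, hy]
    simp [h₃₁]
  have hfδ : f ≫ δ = 0 := by
    rw [← cancel_epi (singleShiftIso X k (k + 1)).hom, ← hy, hy₀]
    simp
  obtain ⟨z, rfl⟩ := exists_comp_mor₂_eq hT f hfδ
  rw [hom_single_eq_zero_of_lt (by lia) z, zero_comp]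

variable (hA : IsHereditary A)
include hA

omit hA [HasDerivedCategory.{w} A] in
-- The kernel of `φ` is in `N (l + 1)` and its image under `εI` lands in `S.X₁`, so `hQ` applies.
lemma mono_of_coreflections {S : ShortComplex A} (hS : S.ShortExact) {l : ℤ} {SI SJ : A}
    {εI : SI ⟶ S.X₂} {εJ : SJ ⟶ S.X₃} (hI : IsCoreflection (N l) εI) (hSJ : N l SJ) {φ : SI ⟶ SJ}
    (hφ : φ ≫ εJ = εI ≫ S.g) (hQ : ∀ X, N (l + 1) X → ∀ f : X ⟶ S.X₁, f = 0) : Mono φ := by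
  have hK := prop_kernel hN φ (hN.le_succ l _ hI.prop) hSJ
  have := hS.mono_f
  refine Preadditive.mono_of_kernel_zero (eq_zero_of_comp_coreflection hN hI hK _ ?_)
  have h : (kernel.ι φ ≫ εI) ≫ S.g = 0 := by
    rw [Category.assoc, ← hφ, kernel.condition_assoc, zero_comp]
  have := hQ _ hK (hS.exact.lift (kernel.ι φ ≫ εI) h)
  rw [← hS.exact.lift_f (kernel.ι φ ≫ εI) h, this, zero_comp]

/-- If `Q` receives no nonzero morphism from `N (l + 1)`, then its `Ext^1 (-, Q)` restricted to
`N l` is represented by an object of `N l`. -/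
lemma exists_universal_extension [EnoughInjectives A] {Q : A} {l : ℤ}
    (hQ : ∀ X, N (l + 1) X → ∀ f : X ⟶ Q, f = 0) :
    ∃ (M : A) (m : (single A l).obj M ⟶ ((single A l).obj Q)⟦(1 : ℤ)⟧), N l M ∧
      (∀ X, N l X → ∀ f : (single A l).obj X ⟶ ((single A l).obj M)⟦(1 : ℤ)⟧, f = 0) ∧
      (∀ X, N l X → ∀ f : (single A l).obj X ⟶ ((single A l).obj Q)⟦(1 : ℤ)⟧,
        ∃ g : X ⟶ M, (single A l).map g ≫ m = f) ∧
      (∀ X, N l X → ∀ f : X ⟶ M, (single A l).map f ≫ m = 0 → f = 0) := by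
  -- Write `S` as `0 → Q → I → J → 0`. For `X` in `N l`, Ext¹(X, Q) is the cokernel of Hom(X, I) →
  -- Hom(X, J), equally of Hom(X, SI) → Hom(X, SJ). As Ext¹(X, SI) = 0, this is Hom(X, SJ/SI), so
  -- the representing object is `cokernel φ`.
  let S : ShortComplex A := ShortComplex.mk (Injective.ι Q) (cokernel.π (Injective.ι Q)) (by simp)
  have hS : S.ShortExact := { exact := ShortComplex.exact_cokernel _ }
  obtain ⟨SI, εI, hI⟩ := exists_isCoreflection hN l S.X₂
  obtain ⟨SJ, εJ, hJ⟩ := exists_isCoreflection hN l S.X₃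
  obtain ⟨φ, hφ⟩ := hJ.exists_lift hI.prop (εI ≫ S.g)
  have : Injective S.X₂ := inferInstanceAs (Injective (Injective.under Q))
  have hI₀ (X : A) (f : (single A l).obj X ⟶ ((single A l).obj S.X₂)⟦(1 : ℤ)⟧) : f = 0 :=
    hom_single_shift_injective_eq_zero f
  have hJ₀ (X : A) (f : (single A l).obj X ⟶ ((single A l).obj S.X₃)⟦(1 : ℤ)⟧) : f = 0 :=
    hom_single_shift_eq_zero_of_shortExact hA hS (hI₀ X) f
  have : Mono φ := mono_of_coreflections hN hS hI hJ.prop hφ hQ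
  let S' : ShortComplex A := ShortComplex.mk φ (cokernel.π φ) (by simp)
  have hS' : S'.ShortExact := { exact := ShortComplex.exact_cokernel _ }
  have hSI (X : A) (hX : N l X) (f : (single A l).obj X ⟶ ((single A l).obj SI)⟦(1 : ℤ)⟧) :
      f = 0 := eq_zero_of_comp_shift_coreflection hN hI hX f (hI₀ X _)
  have hSJ (X : A) (hX : N l X) (f : (single A l).obj X ⟶ ((single A l).obj SJ)⟦(1 : ℤ)⟧) :
      f = 0 := eq_zero_of_comp_shift_coreflection hN hJ hX f (hJ₀ X _)
  obtain ⟨δ, hT⟩ := exists_triangle_of_shortExact hS l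
  obtain ⟨δ', hT'⟩ := exists_triangle_of_shortExact hS' l
  have hm : ∃ m : (single A l).obj (cokernel φ) ⟶ ((single A l).obj Q)⟦(1 : ℤ)⟧,
      (single A l).map (cokernel.π φ) ≫ m = (single A l).map εJ ≫ δ := by
    obtain ⟨m, hm, _⟩ := complete_distinguished_triangle_morphism _ _ hT' (rot_of_distTriang _ hT)
      ((single A l).map εI) ((single A l).map εJ) (by
        refine ((single A l).map_comp _ _).symm.trans (Eq.trans ?_ ((single A l).map_comp _ _))
        exact congrArg _ hφ)
    exact ⟨m, hm⟩
  obtain ⟨m, hm⟩ := hm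
  refine ⟨cokernel φ, m, prop_cokernel hN φ (hN.le_succ l _ hI.prop) hJ.prop, fun X hX f ↦
    hom_single_shift_eq_zero_of_shortExact hA hS' (hSJ X hX) f, fun X hX f ↦ ?_,
    fun X hX f hf ↦ ?_⟩
  · obtain ⟨y, rfl⟩ := exists_comp_mor₃_eq hT f (hI₀ X _)
    obtain ⟨y, rfl⟩ := (single A l).map_surjective y
    obtain ⟨z, rfl⟩ := hJ.exists_lift hX y
    exact ⟨z ≫ cokernel.π φ, by rw [Functor.map_comp, Category.assoc, hm, Functor.map_comp,
      Category.assoc]⟩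
  · obtain ⟨y, hy⟩ := exists_comp_mor₂_eq hT' ((single A l).map f) (hSI X hX _)
    obtain ⟨z, rfl⟩ := (single A l).map_surjective y
    have hy' : z ≫ cokernel.π φ = f :=
      (single A l).map_injective (((single A l).map_comp _ _).trans hy)
    have h₀ : (single A l).map (z ≫ εJ) ≫ δ = 0 := by
      rw [Functor.map_comp, Category.assoc, ← hm, ← Category.assoc, ← Functor.map_comp, hy', hf]
    obtain ⟨v, hv⟩ := exists_comp_mor₂_eq hT _ h₀
    obtain ⟨v, rfl⟩ := (single A l).map_surjective v
    obtain ⟨v', rfl⟩ := hI.exists_lift hX v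
    have hv' : v' ≫ φ = z := hJ.hom_ext hX (by
      rw [Category.assoc, hφ, ← Category.assoc]
      exact (single A l).map_injective (((single A l).map_comp _ _).trans hv))
    rw [← hy', ← hv', Category.assoc, cokernel.condition, comp_zero]

omit hA in
/-- The injectivity statement in `exists_universal_extension` holds for sources in `N (l + 1)`. -/
lemma eq_zero_of_comp_universal_extension {Q M : A} {l : ℤ}
    (hQ : ∀ X, N (l + 1) X → ∀ f : X ⟶ Q, f = 0) (hM : N l M)
    (m : (single A l).obj M ⟶ ((single A l).obj Q)⟦(1 : ℤ)⟧)
    (h₁ : ∀ X, N l X → ∀ f : (single A l).obj X ⟶ ((single A l).obj Q)⟦(1 : ℤ)⟧,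
        ∃ g : X ⟶ M, (single A l).map g ≫ m = f)
    (h₂ : ∀ X, N l X → ∀ f : X ⟶ M, (single A l).map f ≫ m = 0 → f = 0)
    {X : A} (hX : N (l + 1) X) (f : X ⟶ M) (hf : (single A l).map f ≫ m = 0) : f = 0 := by
  let S : ShortComplex A := ShortComplex.mk (kernel.ι f) (Abelian.factorThruImage f)
    (by simp [← cancel_mono (Abelian.image.ι f)])
  have hS : S.ShortExact := by
    let φ : S ⟶ ShortComplex.mk (kernel.ι f) f (by simp) :=
      { τ₁ := 𝟙 _
        τ₂ := 𝟙 _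
        τ₃ := Abelian.image.ι f }
    have : Epi φ.τ₁ := inferInstanceAs (Epi (𝟙 _))
    have : IsIso φ.τ₂ := inferInstanceAs (IsIso (𝟙 _))
    have : Mono φ.τ₃ := inferInstanceAs (Mono (Abelian.image.ι f))
    exact ⟨(ShortComplex.exact_iff_of_epi_of_isIso_of_mono φ).2 (ShortComplex.exact_kernel f)⟩
  let S' : ShortComplex A := ShortComplex.mk (Abelian.image.ι f) (cokernel.π f) (by simp)
  have hS' : S'.ShortExact := { exact := ShortComplex.exact_kernel _ }
  obtain ⟨δ, hT⟩ := exists_triangle_of_shortExact hS l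
  obtain ⟨δ', hT'⟩ := exists_triangle_of_shortExact hS' l
  -- The restriction of `m` to the image of `f` comes from a morphism `kernel f ⟶ Q`, which is zero
  -- since `kernel f` is in `N (l + 1)`.
  have hi : (single A l).map (Abelian.image.ι f) ≫ m = 0 := by
    obtain ⟨y, hy⟩ := exists_mor₃_comp_eq hT ((single A l).map (Abelian.image.ι f) ≫ m) (by
      rw [← Category.assoc, ← Functor.map_comp]
      exact (congrArg (fun f ↦ (single A l).map f ≫ m) (Abelian.image.fac f)).trans hf)
    obtain ⟨y, rfl⟩ := (shiftFunctor _ (1 : ℤ)).map_surjective y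
    obtain ⟨y, rfl⟩ := (single A l).map_surjective y
    have : y = 0 := hQ _ (prop_kernel hN f hX hM) y
    rw [← hy, this]
    simp
  -- So `m` descends to `cokernel f`, an object of `N l`. Representing the descended class gives a
  -- retraction of `cokernel.π f`.
  obtain ⟨y, hy⟩ := exists_mor₂_comp_eq hT' m hi
  obtain ⟨c, rfl⟩ := h₁ _ (prop_cokernel hN f hX hM) y
  have : cokernel.π f ≫ c = 𝟙 M := by
    rw [← sub_eq_zero]
    refine h₂ _ hM _ ?_
    rw [Functor.map_sub, Functor.map_comp, CategoryTheory.Functor.map_id, Preadditive.sub_comp,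
      Category.id_comp, sub_eq_zero, Category.assoc]
    exact hy
  rw [← Category.comp_id f, ← this, cokernel.condition_assoc, zero_comp]

variable [EnoughInjectives A]

/-- Only degrees `l` and `l + 1` can map to the cone of `m`. In degree `l`, universality kills Ext¹
into `Q`, and Ext¹ into `M` is zero. In degree `l + 1`, injectivity of `m` and `hQ` apply. -/
lemma approximable_single_of_hom_eq_zero {Q : A} {l : ℤ}
    (hQ : ∀ X, N (l + 1) X → ∀ f : X ⟶ Q, f = 0) :
    Approximable N ((single A (l + 1)).obj Q) := by
  obtain ⟨M, m, hM, h₀, h₁, h₂⟩ := exists_universal_extension hN hA hQ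
  obtain ⟨C, c, d, hT⟩ := distinguished_cocone_triangle m
  have hmc : m ≫ c = 0 := comp_distTriang_mor_zero₁₂ _ hT
  have hdm : d ≫ m⟦(1 : ℤ)⟧' = 0 := comp_distTriang_mor_zero₃₁ _ hT
  refine (Approximable N).prop_of_iso (singleShiftIso Q l (l + 1))
    ⟨_, _, _, _, _, hT, theta_single hN hM, rightOrthogonal_theta fun i X hX f ↦ ?_⟩
  by_cases hil : i = l
  · subst hil
    obtain ⟨y, rfl⟩ := exists_comp_mor₂_eq hT f (h₀ X hX _)
    obtain ⟨z, rfl⟩ := h₁ X hX y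
    rw [Category.assoc, hmc, comp_zero]
  by_cases hil' : i = l + 1
  · subst hil'
    have hfd : f ≫ d = 0 := by
      obtain ⟨g, hg⟩ := (shiftFunctor _ (1 : ℤ)).map_surjective
        ((singleShiftIso X l (l + 1)).hom ≫ f ≫ d)
      obtain ⟨g, rfl⟩ := (single A l).map_surjective g
      have : g = 0 := eq_zero_of_comp_universal_extension hN hQ hM m h₁ h₂ hX g
        ((shiftFunctor _ (1 : ℤ)).map_injective (by
          rw [Functor.map_comp, hg]
          simp [hdm]))
      rw [← cancel_epi (singleShiftIso X l (l + 1)).hom, ← hg, this]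
      simp
    obtain ⟨y, rfl⟩ := exists_comp_mor₂_eq hT f hfd
    obtain ⟨z, hz⟩ := (single A (l + 1)).map_surjective (y ≫ (singleShiftIso Q l (l + 1)).hom)
    have : y = 0 := by
      rw [← cancel_mono (singleShiftIso Q l (l + 1)).hom, ← hz, hQ X hX z]
      simp
    rw [this, zero_comp]
  · obtain ⟨y, rfl⟩ := exists_comp_mor₂_eq hT f (hom_single_shift_eq_zero hA hil hil' _)
    rw [hom_single_shift_eq_zero hA hil hil' y, zero_comp]

lemma approximable_single (M : A) (k : ℤ) : Approximable N ((single A k).obj M) := by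
  obtain ⟨T, ε, hε⟩ := exists_isCoreflection hN k M
  obtain ⟨C, g, δ, hT⟩ := distinguished_cocone_triangle ((single A k).map ε)
  refine approximable_of_triangle hN hT (theta_single hN hε.prop)
    (approximable_of_homology hN hA C fun j ↦ ?_)
  obtain ⟨i, p, hip, _⟩ := exists_retract_single hA C j
  have : IsSplitMono i := ⟨⟨p, hip⟩⟩
  by_cases hj : j = k
  -- Here the homology is the cokernel of `ε`; Ext¹ from `N l` still has to be removed. In degree `k
  -- + 1` it is the kernel of `ε`, which is already orthogonal.
  · obtain ⟨l, rfl⟩ : ∃ l, j = l + 1 := ⟨j - 1, by lia⟩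
    subst hj
    refine approximable_single_of_hom_eq_zero hN hA fun X hX f ↦ (single A (l + 1)).map_injective ?_
    rw [← cancel_mono i, hom_single_cone_coreflection_eq_zero hN hε hX hT (_ ≫ i)]
    simp
  refine approximable_of_rightOrthogonal hN (rightOrthogonal_theta fun n X hX f ↦ ?_)
  by_cases hj' : j = k + 1
  · subst hj'
    by_cases hn : n = k
    · subst hn
      rw [← cancel_mono i, hom_single_cone_coreflection_eq_zero hN hε hX hT (f ≫ i), zero_comp]
    by_cases hn' : n = k + 1
    · subst hn'
      rw [← cancel_mono i, hom_single_succ_cone_coreflection_eq_zero hN hε hX hT (f ≫ i), zero_comp]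
    · exact hom_single_eq_zero hA hn' (by lia) f
  · refine (Functor.map_isZero _ ?_).eq_of_tgt _ _
    exact isZero_homology_obj₂ _ (rot_of_distTriang _ hT) j (isZero_homology_single M j k hj)
      ((isZero_homology_single T j (k + 1) hj').of_iso
        ((homology j).mapIso (singleShiftIso T k (k + 1))))

lemma approximable (X : DerivedCategory.Bounded A) : Approximable N X :=
  approximable_of_homology hN hA X fun _ ↦ approximable_single hN hA _ _

end Approximation

/-! ### The t-structure of a narrow sequence and the bijection -/

section MainTheorem

lemma tStructure_ext {C : Type*} [Category* C] [Preadditive C] [HasZeroObject C] [HasShift C ℤ]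
    [∀ (n : ℤ), (shiftFunctor C n).Additive] [Pretriangulated C] {t₁ t₂ : TStructure C}
    (h : t₁.le 0 = t₂.le 0) : t₁ = t₂ := by
  have hle : t₁.le = t₂.le := by
    ext n X
    have h₁ := t₁.shift_le n 0 n (by lia)
    have h₂ := t₂.shift_le n 0 n (by lia)
    rw [← h₁, ← h₂, h]
  have hge : t₁.ge = t₂.ge := by
    ext n X
    rw [TStructure.ge_iff_isGE, TStructure.ge_iff_isGE, t₁.isGE_iff_orthogonal (n - 1) n (by lia),
      t₂.isGE_iff_orthogonal (n - 1) n (by lia)]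
    simp only [← TStructure.le_iff_isLE, hle]
  cases t₁
  cases t₂
  congr

variable {A : Type u} [Category.{v} A] [Abelian A] [HasDerivedCategory.{w} A]
  {N : ℤ → ObjectProperty A} (hN : IsCoreflectiveNarrowSequence N)

include hN

lemma mu_theta : mu (theta N) = N := by
  ext k M
  have := isClosedUnderIsomorphisms hN k
  constructor
  · rintro ⟨X, hX, ⟨e⟩⟩
    exact (N k).prop_of_iso e (hX k)
  · exact fun h ↦ ⟨_, theta_single hN h, ⟨(singleHomologyIso A k).app M⟩⟩

lemma rightOrthogonal_theta_shift {X : DerivedCategory.Bounded A}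
    (hX : (theta N).rightOrthogonal X) : (theta N).rightOrthogonal (X⟦(-1 : ℤ)⟧) := by
  intro U f hU
  let e : X⟦(-1 : ℤ)⟧⟦(1 : ℤ)⟧ ≅ X := (shiftEquiv _ (1 : ℤ)).counitIso.app X
  apply (shiftFunctor _ (1 : ℤ)).map_injective
  rw [← cancel_mono e.hom, hX (f⟦(1 : ℤ)⟧' ≫ e.hom) (theta_shift hN hU), Functor.map_zero,
    zero_comp]

/-- The t-structure attached to a coreflective narrow sequence. -/
noncomputable def tStructureOfNarrow [EnoughInjectives A] (hA : IsHereditary A) :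
    TStructure (DerivedCategory.Bounded A) where
  le n := (theta N).shift n
  -- The right orthogonal of `le 0` is `ge 1`, not `ge 0`; hence the shift by `n - 1`.
  ge n := (theta N).rightOrthogonal.shift (n - 1)
  le_isClosedUnderIsomorphisms n := by
    have := isClosedUnderIsomorphisms_theta hN
    infer_instance
  ge_isClosedUnderIsomorphisms n := inferInstance
  le_shift n a n' h X hX := by
    have := isClosedUnderIsomorphisms_theta hN
    exact (theta N).prop_of_iso ((shiftFunctorAdd' _ a n' n h).app X) hX
  ge_shift n a n' h X hX := (theta N).rightOrthogonal.prop_of_iso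
      ((shiftFunctorAdd' _ a (n' - 1) (n - 1) (by lia)).app X) hX
  zero' X Y f hX hY := by
    have := isClosedUnderIsomorphisms_theta hN
    exact (theta N).rightOrthogonal.prop_of_iso ((shiftFunctorZero _ ℤ).app Y) hY f
      ((theta N).prop_of_iso ((shiftFunctorZero _ ℤ).app X) hX)
  le_zero_le X hX := by
    have := isClosedUnderIsomorphisms_theta hN
    exact theta_shift hN ((theta N).prop_of_iso ((shiftFunctorZero _ ℤ).app X) hX)
  ge_one_le X hX := rightOrthogonal_theta_shift hN
    ((theta N).rightOrthogonal.prop_of_iso ((shiftFunctorZero _ ℤ).app X) hX)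
  exists_triangle_zero_one X := by
    have := isClosedUnderIsomorphisms_theta hN
    obtain ⟨U, V, f, g, δ, hT, hU, hV⟩ := approximable hN hA X
    exact ⟨U, V, (theta N).prop_of_iso ((shiftFunctorZero _ ℤ).symm.app U) hU,
      (theta N).rightOrthogonal.prop_of_iso ((shiftFunctorZero _ ℤ).symm.app V) hV, f, g, δ, hT⟩

lemma tStructureOfNarrow_le_zero [EnoughInjectives A] (hA : IsHereditary A) :
    (tStructureOfNarrow hN hA).le 0 = theta N := by
  have := isClosedUnderIsomorphisms_theta hN
  exact (theta N).shift_zero ℤ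

end MainTheorem

end NarrowSequences

theorem mainTheorem2 {A : Type u} [Category.{v} A] [Abelian A] [HasDerivedCategory.{w} A]
    [EnoughInjectives A] (hA : NarrowSequences.IsHereditary A) :
    ∃ e : TStructure (DerivedCategory.Bounded A) ≃
        {N : ℤ → ObjectProperty A // NarrowSequences.IsCoreflectiveNarrowSequence N},
      (∀ t : TStructure (DerivedCategory.Bounded A),
        (e t).1 = NarrowSequences.mu (t.le 0)) ∧
      (∀ N : {N : ℤ → ObjectProperty A // NarrowSequences.IsCoreflectiveNarrowSequence N},
        (e.symm N).le 0 = NarrowSequences.theta N.1) :=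
  ⟨{  toFun t := ⟨NarrowSequences.mu (t.le 0), NarrowSequences.isCoreflectiveNarrowSequence_mu hA t⟩
      invFun N := NarrowSequences.tStructureOfNarrow N.2 hA
      left_inv t := NarrowSequences.tStructure_ext
        ((NarrowSequences.tStructureOfNarrow_le_zero _ hA).trans (NarrowSequences.theta_mu hA t))
      right_inv N := Subtype.ext ((congrArg NarrowSequences.mu
        (NarrowSequences.tStructureOfNarrow_le_zero N.2 hA)).trans
          (NarrowSequences.mu_theta N.2)) },
    fun _ ↦ rfl, fun N ↦ NarrowSequences.tStructureOfNarrow_le_zero N.2 hA⟩
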